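/- For $n\ge 1$, a polytope in $\mathbb R^n$ is the convex hull of a finite set of points, and its vertices are its extreme points. For a polytope $K\subset\mathbb R^n$ with non-empty interior and $z\in\operatorname{int}K$, let $K^z=\{y\in\mathbb R^n : \langle y-z,x-z\rangle\le 1 \text{ for all } x\in K\}$ be the polar body of $K$ with center $z$, and let $$\mathcal P(K)=\inf\{|K|\,|K^z| : z\in\operatorname{int}K\}$$ be its volume product, where $|\cdot|$ denotes Lebesgue measure on $\mathbb R^n$. For $m\ge n+1$ let $\mathbb P^n_m$ be the set of all polytopes in $\mathbb R^n$ with non-empty interior and at most $m$ vertices, and let $M^n_m=\sup_{K\in\mathbb P^n_m}\mathcal P(K)$. **Theorem.** Let $n\ge 1$. 1. For every $m\ge n+1$, the supremum $M^n_m$ is finite and is attained at some $K\in\mathbb P^n_m$. 2. Let $m\ge n+1$, and suppose that $n\ge 2$ or $m=n+1$. Then every $K\in\mathbb P^n_m$ with $\mathcal P(K)=M^n_m$ has exactly $m$ vertices. 3. If $n\ge 2$, then the sequence $(M^n_m)_{m\ge n+1}$ is strictly increasing in $m$. -/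

import Mathlib

open MeasureTheory

open scoped ENNReal

noncomputable section

/-- The polar body `K^z = {y : ⟪y - z, x - z⟫ ≤ 1 for all x ∈ K}` of `K` with respect to the
center `z`. (This is the one-sided polar; Mathlib's polar uses the absolute value.) -/
def polarAt {n : ℕ} (K : Set (EuclideanSpace ℝ (Fin n))) (z : EuclideanSpace ℝ (Fin n)) :
    Set (EuclideanSpace ℝ (Fin n)) :=
  {y | ∀ x ∈ K, inner ℝ (y - z) (x - z) ≤ 1}

/-- The volume product `P(K) = inf {|K| |K^z| : z ∈ int K}`, where `|·|` is Lebesgue measure.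
It takes values in `[0, ∞]`, so that neither the volumes nor the infimum have junk values. -/
def volumeProduct {n : ℕ} (K : Set (EuclideanSpace ℝ (Fin n))) : ℝ≥0∞ :=
  ⨅ z ∈ interior K, volume K * volume (polarAt K z)

/-- A polytope is the convex hull of a finite set of points. -/
def IsPolytope {n : ℕ} (K : Set (EuclideanSpace ℝ (Fin n))) : Prop :=
  ∃ S : Set (EuclideanSpace ℝ (Fin n)), S.Finite ∧ K = convexHull ℝ S

/-- The number of vertices of a polytope; the vertices are its extreme points
(finite in number, since they all belong to any finite set whose convex hull is the polytope). -/
def numVertices {n : ℕ} (K : Set (EuclideanSpace ℝ (Fin n))) : ℕ :=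
  (K.extremePoints ℝ).ncard

/-- The polytopes in `ℝⁿ` with nonempty interior and at most `m` vertices. -/
def polytopes (n m : ℕ) : Set (Set (EuclideanSpace ℝ (Fin n))) :=
  {K | IsPolytope K ∧ (interior K).Nonempty ∧ numVertices K ≤ m}

/-- `M^n_m`, the supremum of the volume product over the polytopes in `ℝⁿ` with nonempty interior
and at most `m` vertices. -/
def supVolumeProduct (n m : ℕ) : ℝ≥0∞ :=
  ⨆ K ∈ polytopes n m, volumeProduct K

end

/-!
The supremum is attained by compactness. The volume product is affinely invariant
(`volumeProduct_image_linearEquiv`, `volumeProduct_image_add`). Given a polytope, move one vertex to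
the origin and, among the bases formed by the other vertices, map one with determinant of maximal
absolute value to the standard basis; by Cramer's rule all vertices then lie in the cube
`[-1, 1]ⁿ` (`exists_basis_mem_abs_repr_le_one`). So only configurations of `m` points in the cube
that contain the vertices of the standard simplex have to be considered. They form a compact set
(`isCompact_normalizedConfigurations`), and the volume product of the convex hull is upper
semicontinuous in the configuration
(`upperSemicontinuous_volumeProduct_convexHull_range`), because it is an infimum, over the centers
`z`, of functions that vary little with the configuration.

The remaining claims follow from the fact that in dimension `n ≥ 2` the volume product of a polytope
`K` can be increased by adding one vertex (`exists_volumeProduct_insert_gt`). Put the origin in the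
interior of `K`, take a point `p` in the relative interior of a facet, and let `K'` be the convex
hull of `K` and `(1 + t) • p`.
* The volume grows by at least `q * t` with `q > 0` (`exists_volume_gain`).
* For centers `z` at distance at least `δ` from the complement of `K`, the volume of the polar body
  drops by at most `c * t ^ n`, since only a neighborhood of one of its vertices is cut off
  (`exists_volume_polar_loss`). As `n ≥ 2`, for small `t` the gain outweighs this loss.
* For all other centers in `K'`, the volume of the polar body of `K'` is so large that they do not
  matter for the infimum (`exists_volume_polar_ge`).

For `m = n + 1`, the number of vertices is exact because a polytope with nonempty interior has at
least `n + 1` of them (`add_one_le_numVertices`).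
-/

open Set Metric Filter Topology
open scoped Pointwise

/-! ### Polar bodies -/

/-- The polar body `K^z` translated by `-z`, so that its center is the origin. -/
def centeredPolar {n : ℕ} (K : Set (EuclideanSpace ℝ (Fin n))) (z : EuclideanSpace ℝ (Fin n)) :
    Set (EuclideanSpace ℝ (Fin n)) :=
  {y | ∀ x ∈ K, inner ℝ y (x - z) ≤ 1}

theorem volume_polarAt {n : ℕ} (K : Set (EuclideanSpace ℝ (Fin n)))
    (z : EuclideanSpace ℝ (Fin n)) : volume (polarAt K z) = volume (centeredPolar K z) := by
  have h : polarAt K z = (fun y => y + -z) ⁻¹' centeredPolar K z := by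
    ext y
    simp [polarAt, centeredPolar, sub_eq_add_neg]
  rw [h, measure_preimage_add_right]

theorem centeredPolar_anti {n : ℕ} {K L : Set (EuclideanSpace ℝ (Fin n))} (h : K ⊆ L)
    (z : EuclideanSpace ℝ (Fin n)) : centeredPolar L z ⊆ centeredPolar K z :=
  fun _ hy x hx => hy x (h hx)

theorem convex_inner_sub_le {n : ℕ} (y z : EuclideanSpace ℝ (Fin n)) (c : ℝ) :
    Convex ℝ {x | inner ℝ y (x - z) ≤ c} := by
  have h : {x | inner ℝ y (x - z) ≤ c} = {x | (innerSL ℝ y) x ≤ c + inner ℝ y z} := by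
    ext x
    simp [inner_sub_right]
  rw [h]
  exact convex_halfSpace_le (innerSL ℝ y).toLinearMap.isLinear _

theorem inner_sub_le_of_mem_convexHull {n : ℕ} {S : Set (EuclideanSpace ℝ (Fin n))}
    {y z x : EuclideanSpace ℝ (Fin n)} {c : ℝ} (h : ∀ x ∈ S, inner ℝ y (x - z) ≤ c)
    (hx : x ∈ convexHull ℝ S) : inner ℝ y (x - z) ≤ c :=
  convexHull_min (t := {x | inner ℝ y (x - z) ≤ c}) h (convex_inner_sub_le y z c) hx

theorem centeredPolar_convexHull {n : ℕ} (S : Set (EuclideanSpace ℝ (Fin n)))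
    (z : EuclideanSpace ℝ (Fin n)) :
    centeredPolar (convexHull ℝ S) z = centeredPolar S z :=
  Subset.antisymm (centeredPolar_anti (subset_convexHull ℝ S) z)
    fun _ hy _ hx => inner_sub_le_of_mem_convexHull hy hx

theorem convex_centeredPolar {n : ℕ} (K : Set (EuclideanSpace ℝ (Fin n)))
    (z : EuclideanSpace ℝ (Fin n)) : Convex ℝ (centeredPolar K z) := by
  intro y hy w hw a b ha hb hab x hx
  rw [inner_add_left, inner_smul_left, inner_smul_left]
  simp only [conj_trivial]
  nlinarith [mul_le_mul_of_nonneg_left (hy x hx) ha, mul_le_mul_of_nonneg_left (hw x hx) hb]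

theorem isClosed_centeredPolar {n : ℕ} (K : Set (EuclideanSpace ℝ (Fin n)))
    (z : EuclideanSpace ℝ (Fin n)) : IsClosed (centeredPolar K z) := by
  have h : centeredPolar K z = ⋂ x ∈ K, {y | inner ℝ y (x - z) ≤ 1} := by
    ext y
    simp [centeredPolar]
  rw [h]
  exact isClosed_biInter fun x _ => isClosed_le (by fun_prop) continuous_const

theorem add_div_norm_smul_mem_closedBall {n : ℕ} {z y : EuclideanSpace ℝ (Fin n)} {ρ : ℝ}
    (hρ : 0 ≤ ρ) : z + (ρ / ‖y‖) • y ∈ closedBall z ρ := by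
  rw [mem_closedBall, dist_eq_norm, add_sub_cancel_left, norm_smul, Real.norm_eq_abs,
    abs_of_nonneg (by positivity)]
  rcases eq_or_ne ‖y‖ 0 with h | h
  · simpa [h] using hρ
  · rw [div_mul_cancel₀ _ h]

theorem div_norm_mul_inner_self {n : ℕ} (y : EuclideanSpace ℝ (Fin n)) (ρ : ℝ) :
    ρ / ‖y‖ * inner ℝ y y = ρ * ‖y‖ := by
  rw [real_inner_self_eq_norm_sq]
  rcases eq_or_ne ‖y‖ 0 with h | h
  · simp [h]
  · field_simp

theorem mul_norm_le_of_inner_sub_le {n : ℕ} {K : Set (EuclideanSpace ℝ (Fin n))}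
    {y z : EuclideanSpace ℝ (Fin n)} {ρ c : ℝ} (hρ : 0 ≤ ρ) (hK : closedBall z ρ ⊆ K)
    (hy : ∀ x ∈ K, inner ℝ y (x - z) ≤ c) : ρ * ‖y‖ ≤ c := by
  have := hy _ (hK (add_div_norm_smul_mem_closedBall (y := y) hρ))
  rwa [add_sub_cancel_left, inner_smul_right, div_norm_mul_inner_self] at this

theorem centeredPolar_subset_closedBall {n : ℕ} {K : Set (EuclideanSpace ℝ (Fin n))}
    {z : EuclideanSpace ℝ (Fin n)} {ρ : ℝ} (hρ : 0 < ρ) (hK : closedBall z ρ ⊆ K) :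
    centeredPolar K z ⊆ closedBall 0 (1 / ρ) := by
  intro y hy
  rw [mem_closedBall_zero_iff, le_div_iff₀ hρ, mul_comm]
  exact mul_norm_le_of_inner_sub_le hρ.le hK hy

theorem ball_subset_centeredPolar {n : ℕ} {K : Set (EuclideanSpace ℝ (Fin n))}
    {z : EuclideanSpace ℝ (Fin n)} {D : ℝ} (hD : 0 < D) (hK : K ⊆ closedBall z D) :
    ball 0 (1 / D) ⊆ centeredPolar K z := by
  intro y hy x hx
  have h1 : ‖y‖ < 1 / D := by simpa using hy
  have h2 : ‖x - z‖ ≤ D := by simpa [dist_eq_norm] using hK hx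
  calc inner ℝ y (x - z) ≤ ‖y‖ * ‖x - z‖ := real_inner_le_norm _ _
    _ ≤ 1 / D * D := by gcongr
    _ = 1 := by field_simp

theorem exists_inner_lt_of_not_closedBall_subset {n : ℕ} {K : Set (EuclideanSpace ℝ (Fin n))}
    {z : EuclideanSpace ℝ (Fin n)} {ρ : ℝ} (hK : Convex ℝ K) (hKc : IsClosed K)
    (hne : K.Nonempty) (h : ¬ closedBall z ρ ⊆ K) :
    ∃ u : EuclideanSpace ℝ (Fin n), u ≠ 0 ∧ ∀ x ∈ K, inner ℝ u (x - z) < ρ * ‖u‖ := by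
  obtain ⟨q, hq, hqK⟩ := not_subset.1 h
  obtain ⟨f, c, hf, hc⟩ := geometric_hahn_banach_closed_point hK hKc hqK
  set u := (InnerProductSpace.toDual ℝ (EuclideanSpace ℝ (Fin n))).symm f with hu
  have hfu : ∀ x, f x = inner ℝ u x := fun x => by simp [hu]
  have hlt : ∀ x ∈ K, inner ℝ u (x - z) < inner ℝ u (q - z) := fun x hx => by
    have := (hf x hx).trans hc
    rw [hfu, hfu] at this
    rw [inner_sub_right, inner_sub_right]
    linarith
  refine ⟨u, ?_, fun x hx => (hlt x hx).trans_le ?_⟩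
  · rintro h0
    obtain ⟨x, hx⟩ := hne
    simpa [h0] using hlt x hx
  · calc inner ℝ u (q - z) ≤ ‖u‖ * ‖q - z‖ := real_inner_le_norm _ _
      _ ≤ ‖u‖ * ρ := by
        gcongr
        simpa [dist_eq_norm] using hq
      _ = ρ * ‖u‖ := mul_comm _ _

/-- A convex set that contains a ball around the origin and a far away point has large volume,
since it contains many disjoint balls along the segment from the origin to that point. -/
theorem mul_volume_ball_le_of_convex {n : ℕ} {C : Set (EuclideanSpace ℝ (Fin n))}
    (hC : Convex ℝ C) {r : ℝ} (hr : 0 < r) (hball : ball 0 r ⊆ C)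
    {w : EuclideanSpace ℝ (Fin n)} (hw : w ∈ C) (N : ℕ) (hN : 2 * r * N ≤ ‖w‖) :
    (N : ℝ≥0∞) * volume (ball (0 : EuclideanSpace ℝ (Fin n)) (r / 2)) ≤ volume C := by
  rcases Nat.eq_zero_or_pos N with rfl | hNpos
  · simp
  have hNr : (0 : ℝ) < N := by exact_mod_cast hNpos
  have hwpos : 0 < ‖w‖ := lt_of_lt_of_le (by positivity) hN
  -- the centers lie on the first half of the segment, at mutual distance at least `r`
  set c : Fin N → EuclideanSpace ℝ (Fin n) := fun k => ((k : ℝ) * r / ‖w‖) • w with hc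
  have hsub : (⋃ k : Fin N, ball (c k) (r / 2)) ⊆ C := by
    refine iUnion_subset fun k y hy => ?_
    have hk : (k : ℝ) ≤ N := by exact_mod_cast k.2.le
    set s : ℝ := (k : ℝ) * r / ‖w‖ with hs
    have hs0 : 0 ≤ s := by positivity
    have hs1 : s ≤ 1 / 2 := by
      rw [hs, div_le_iff₀ hwpos]
      nlinarith
    have hb : (1 - s)⁻¹ • (y - s • w) ∈ C := by
      apply hball
      rw [mem_ball_zero_iff, norm_smul, norm_inv, Real.norm_eq_abs, abs_of_pos (by linarith),
        inv_mul_lt_iff₀ (by linarith)]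
      have : ‖y - s • w‖ < r / 2 := by simpa [hc, dist_eq_norm] using hy
      nlinarith
    have := hC hb hw (a := 1 - s) (b := s) (by linarith) hs0 (by ring)
    rwa [smul_smul, mul_inv_cancel₀ (by linarith), one_smul, sub_add_cancel] at this
  have hdisj : Pairwise (Function.onFun Disjoint fun k : Fin N => ball (c k) (r / 2)) := by
    intro i j hij
    refine ball_disjoint_ball ?_
    rw [add_halves, dist_eq_norm]
    simp only [hc]
    rw [← sub_smul, norm_smul, ← sub_div, ← sub_mul, norm_div, norm_norm, norm_mul,
      div_mul_cancel₀ _ hwpos.ne', Real.norm_eq_abs, Real.norm_eq_abs, abs_of_pos hr]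
    have h1 : (1 : ℝ) ≤ |(i : ℝ) - j| := by
      have : (1 : ℤ) ≤ |((i : ℕ) : ℤ) - (j : ℕ)| := by
        rw [← zero_add (1 : ℤ), Int.add_one_le_iff, abs_pos, sub_ne_zero]
        exact_mod_cast fun h => hij (Fin.ext h)
      exact_mod_cast this
    nlinarith
  calc (N : ℝ≥0∞) * volume (ball (0 : EuclideanSpace ℝ (Fin n)) (r / 2))
      = ∑ k : Fin N, volume (ball (c k) (r / 2)) := by
        simp [Measure.addHaar_ball_center]
    _ = volume (⋃ k : Fin N, ball (c k) (r / 2)) := by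
        rw [measure_iUnion hdisj fun _ => measurableSet_ball, tsum_fintype]
    _ ≤ volume C := measure_mono hsub

/-! ### Affine invariance of the volume product -/

theorem det_adjoint_euclidean {n : ℕ}
    (f : EuclideanSpace ℝ (Fin n) →ₗ[ℝ] EuclideanSpace ℝ (Fin n)) :
    LinearMap.det (LinearMap.adjoint f) = LinearMap.det f := by
  let b := EuclideanSpace.basisFun (Fin n) ℝ
  rw [← LinearMap.det_toMatrix b.toBasis, ← LinearMap.det_toMatrix b.toBasis f,
    LinearMap.toMatrix_adjoint, Matrix.det_conjTranspose, star_trivial]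

theorem volumeProduct_image_linearEquiv {n : ℕ}
    (f : EuclideanSpace ℝ (Fin n) ≃L[ℝ] EuclideanSpace ℝ (Fin n))
    (K : Set (EuclideanSpace ℝ (Fin n))) : volumeProduct (f '' K) = volumeProduct K := by
  set g : EuclideanSpace ℝ (Fin n) →ₗ[ℝ] EuclideanSpace ℝ (Fin n) :=
    f.toLinearEquiv.toLinearMap with hg
  have hgf : ∀ x, g x = f x := fun _ => rfl
  have hdet : LinearMap.det g ≠ 0 := (LinearEquiv.isUnit_det' f.toLinearEquiv).ne_zero
  have hvol : volume (f '' K) = ENNReal.ofReal |LinearMap.det g| * volume K :=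
    Measure.addHaar_image_linearMap volume g K
  have hpol : ∀ z, centeredPolar (f '' K) (f z) =
      LinearMap.adjoint g ⁻¹' centeredPolar K z := fun z => by
    ext y
    simp only [centeredPolar, forall_mem_image, mem_ofPred_eq, mem_preimage,
      LinearMap.adjoint_inner_left, hgf, map_sub]
  have hz : ∀ z, volume (f '' K) * volume (polarAt (f '' K) (f z)) =
      volume K * volume (polarAt K z) := fun z => by
    rw [volume_polarAt, volume_polarAt, hvol, hpol, Measure.addHaar_preimage_linearMap _
      (by rwa [det_adjoint_euclidean]), det_adjoint_euclidean, mul_mul_mul_comm,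
      ← ENNReal.ofReal_mul (abs_nonneg _), ← abs_mul, mul_inv_cancel₀ hdet]
    simp
  unfold volumeProduct
  have hint : interior (f '' K) = f '' interior K := (f.toHomeomorph.image_interior K).symm
  rw [hint, iInf_image]
  simp only [hz]

theorem volumeProduct_image_add {n : ℕ} (v : EuclideanSpace ℝ (Fin n))
    (K : Set (EuclideanSpace ℝ (Fin n))) :
    volumeProduct ((fun x => x + v) '' K) = volumeProduct K := by
  have hpol : ∀ z, centeredPolar ((fun x => x + v) '' K) (z + v) = centeredPolar K z :=
    fun z => by
      ext y
      simp only [centeredPolar, forall_mem_image, mem_ofPred_eq, add_sub_add_right_eq_sub]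
  unfold volumeProduct
  have hint : interior ((fun x => x + v) '' K) = (fun x => x + v) '' interior K :=
    ((Homeomorph.addRight v).image_interior K).symm
  have hvol : volume ((fun x => x + v) '' K) = volume K := by simp
  rw [hint, iInf_image, hvol]
  simp only [volume_polarAt, hpol]

theorem volumeProduct_lt_top {n : ℕ} {K : Set (EuclideanSpace ℝ (Fin n))} (hK : IsCompact K)
    (hne : (interior K).Nonempty) : volumeProduct K < ⊤ := by
  obtain ⟨z, hz⟩ := hne
  obtain ⟨ρ, hρ, hb⟩ := nhds_basis_closedBall.mem_iff.1 (mem_interior_iff_mem_nhds.1 hz)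
  refine (iInf₂_le z hz).trans_lt (ENNReal.mul_lt_top hK.measure_lt_top ?_)
  rw [volume_polarAt]
  exact (measure_mono (centeredPolar_subset_closedBall hρ hb)).trans_lt measure_closedBall_lt_top

theorem convexHull_image_add {n : ℕ} (v : EuclideanSpace ℝ (Fin n))
    (T : Set (EuclideanSpace ℝ (Fin n))) :
    convexHull ℝ ((fun x => x + v) '' T) = (fun x => x + v) '' convexHull ℝ T := by
  simpa [add_comm] using ((AffineEquiv.constVAdd ℝ (EuclideanSpace ℝ (Fin n))
    v).toAffineMap.image_convexHull T).symm

/-! ### Spanning sets -/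

theorem affineSpan_eq_top_of_zero_mem {V : Type*} [AddCommGroup V] [Module ℝ V] {T : Set V}
    (h0 : (0 : V) ∈ affineSpan ℝ T) (hT : Submodule.span ℝ T = ⊤) : affineSpan ℝ T = ⊤ := by
  rw [← AffineSubspace.direction_eq_top_iff_of_nonempty ⟨0, h0⟩, eq_top_iff, ← hT,
    Submodule.span_le]
  intro x hx
  simpa using AffineSubspace.vsub_mem_direction (subset_affineSpan ℝ T hx) h0

theorem exists_basis_mem_of_span_eq_top {n : ℕ} {A : Set (EuclideanSpace ℝ (Fin n))}
    (hA : Submodule.span ℝ A = ⊤) :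
    ∃ b : Module.Basis (Fin n) ℝ (EuclideanSpace ℝ (Fin n)), ∀ i, b i ∈ A := by
  let b := Module.Basis.ofSpan hA.ge
  let e := b.indexEquiv (EuclideanSpace.basisFun (Fin n) ℝ).toBasis
  refine ⟨b.reindex e, fun i => ?_⟩
  rw [Module.Basis.reindex_apply]
  exact Module.Basis.ofSpan_subset hA.ge (mem_range_self _)

/-! ### Adding a vertex beyond a facet -/

/-- Existence of a facet of a polytope `convexHull ℝ S` around the origin, given by its normal `ν`
and by a basis made of points of `S` on the facet. The normal is an extreme point of the polar
body: if the points of `S` on its hyperplane did not span, then `ν` could be moved in both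
directions orthogonal to them. -/
theorem exists_facet {n : ℕ} {S : Set (EuclideanSpace ℝ (Fin n))} (hS : S.Finite)
    (h0 : (0 : EuclideanSpace ℝ (Fin n)) ∈ interior (convexHull ℝ S)) :
    ∃ (ν : EuclideanSpace ℝ (Fin n)) (v : Module.Basis (Fin n) ℝ (EuclideanSpace ℝ (Fin n))),
      (∀ i, v i ∈ S) ∧ (∀ i, inner ℝ ν (v i) = 1) ∧ ∀ x ∈ convexHull ℝ S, inner ℝ ν x ≤ 1 := by
  obtain ⟨ρ, hρ, hball⟩ := nhds_basis_closedBall.mem_iff.1 (mem_interior_iff_mem_nhds.1 h0)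
  have hcomp : IsCompact (centeredPolar (convexHull ℝ S) 0) :=
    (isCompact_closedBall _ _).of_isClosed_subset (isClosed_centeredPolar _ _)
      (centeredPolar_subset_closedBall hρ hball)
  obtain ⟨ν, hν⟩ := hcomp.extremePoints_nonempty ⟨0, fun x _ => by simp⟩
  have hνP := extremePoints_subset hν
  have hνle : ∀ x ∈ convexHull ℝ S, inner ℝ ν x ≤ 1 := fun x hx => by simpa using hνP x hx
  set A : Set (EuclideanSpace ℝ (Fin n)) := {x ∈ S | inner ℝ ν x = 1} with hA
  have hspan : Submodule.span ℝ A = ⊤ := by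
    by_contra hne
    rw [← Submodule.orthogonal_eq_bot_iff] at hne
    obtain ⟨w, hw, hw0⟩ := Submodule.exists_mem_ne_zero_of_ne_bot hne
    have hev : ∀ᶠ ε : ℝ in 𝓝 0, ∀ x ∈ S,
        inner ℝ (ν + ε • w) x ≤ 1 ∧ inner ℝ (ν - ε • w) x ≤ 1 := by
      rw [eventually_all_finite hS]
      intro x hx
      by_cases hx1 : inner ℝ ν x = 1
      · have hwx : inner ℝ w x = 0 :=
          Submodule.inner_left_of_mem_orthogonal
            (Submodule.subset_span (show x ∈ A from ⟨hx, hx1⟩)) hw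
        refine Eventually.of_forall fun ε => ?_
        simp [inner_add_left, inner_sub_left, inner_smul_left, hwx, hx1]
      · have hlt : inner ℝ ν x < 1 := lt_of_le_of_ne (hνle x (subset_convexHull ℝ S hx)) hx1
        have c1 : Continuous fun ε : ℝ => inner ℝ (ν + ε • w) x := by fun_prop
        have c2 : Continuous fun ε : ℝ => inner ℝ (ν - ε • w) x := by fun_prop
        have e1 := (c1.tendsto 0).eventually_lt_const (u := 1) (by simpa using hlt)
        have e2 := (c2.tendsto 0).eventually_lt_const (u := 1) (by simpa using hlt)
        filter_upwards [e1, e2] with ε h1 h2 using ⟨h1.le, h2.le⟩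
    obtain ⟨ε, hε, hε0⟩ := ((hev.filter_mono nhdsWithin_le_nhds).and
      (self_mem_nhdsWithin (s := Ioi (0 : ℝ)))).exists
    have hmem : ∀ y : EuclideanSpace ℝ (Fin n), (∀ x ∈ S, inner ℝ y x ≤ 1) →
        y ∈ centeredPolar (convexHull ℝ S) 0 := fun y hy => by
      rw [centeredPolar_convexHull]
      intro x hx
      simpa using hy x hx
    have hseg : ν ∈ openSegment ℝ (ν + ε • w) (ν - ε • w) := by
      refine ⟨1 / 2, 1 / 2, by norm_num, by norm_num, by norm_num, ?_⟩
      module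
    have := ((mem_extremePoints.1 hν).2 _ (hmem _ fun x hx => (hε x hx).1) _
      (hmem _ fun x hx => (hε x hx).2) hseg).1
    rw [add_eq_left, smul_eq_zero] at this
    exact this.elim (ne_of_gt hε0) hw0
  obtain ⟨b, hb⟩ := exists_basis_mem_of_span_eq_top hspan
  exact ⟨ν, b, fun i => (hb i).1, fun i => (hb i).2, hνle⟩

theorem inner_centroid_eq_one {n : ℕ} (hn : 0 < n) {ν : EuclideanSpace ℝ (Fin n)}
    {v : Fin n → EuclideanSpace ℝ (Fin n)} (hv : ∀ i, inner ℝ ν (v i) = 1) :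
    inner ℝ ν ((n : ℝ)⁻¹ • ∑ i, v i) = 1 := by
  have : (n : ℝ) ≠ 0 := by positivity
  simp [inner_smul_right, inner_sum, hv, this]

theorem centroid_mem_convexHull {n : ℕ} (hn : 0 < n) {S : Set (EuclideanSpace ℝ (Fin n))}
    {v : Fin n → EuclideanSpace ℝ (Fin n)} (hv : ∀ i, v i ∈ S) :
    (n : ℝ)⁻¹ • ∑ i, v i ∈ convexHull ℝ S := by
  have : (n : ℝ) ≠ 0 := by positivity
  rw [Finset.smul_sum]
  exact (convex_convexHull ℝ S).sum_mem (fun _ _ => by positivity) (by simp [this])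
    fun i _ => subset_convexHull ℝ S (hv i)

/-- Moving a point of a facet outwards by `t` adds at least a multiple of `t` to the volume: the
affine map that fixes the facet hyperplane and sends the apex `2 • p` to `(1 + t) • p` has
determinant `t`, and it maps a fixed cap over the facet into the added part. -/
theorem exists_volume_gain {n : ℕ} (hn : 0 < n) {S : Set (EuclideanSpace ℝ (Fin n))}
    (hS : S.Finite) {ν p : EuclideanSpace ℝ (Fin n)}
    (v : Module.Basis (Fin n) ℝ (EuclideanSpace ℝ (Fin n))) (hvS : ∀ i, v i ∈ S)
    (hv : ∀ i, inner ℝ ν (v i) = 1) (hν : ∀ x ∈ convexHull ℝ S, inner ℝ ν x ≤ 1)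
    (hp : p = (n : ℝ)⁻¹ • ∑ i, v i) :
    ∃ q : ℝ≥0∞, q ≠ 0 ∧ ∀ t : ℝ, 0 < t →
      volume (convexHull ℝ S) + ENNReal.ofReal t * q ≤
        volume (convexHull ℝ (insert ((1 + t) • p) S)) := by
  have hνp : inner ℝ ν p = 1 := hp ▸ inner_centroid_eq_one hn hv
  have hν0 : ν ≠ 0 := by
    rintro rfl
    simp at hνp
  set T : Set (EuclideanSpace ℝ (Fin n)) := insert ((2 : ℝ) • p) (range v) with hT
  have hpT : p ∈ affineSpan ℝ T := convexHull_subset_affineSpan T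
    (hp ▸ centroid_mem_convexHull hn fun i => mem_insert_of_mem _ (mem_range_self i))
  have h0T : (0 : EuclideanSpace ℝ (Fin n)) ∈ affineSpan ℝ T := by
    have := AffineMap.lineMap_mem (2 : ℝ)
      (subset_affineSpan ℝ T (mem_insert ((2 : ℝ) • p) (range v))) hpT
    have e : AffineMap.lineMap ((2 : ℝ) • p) p (2 : ℝ) = 0 := by
      rw [AffineMap.lineMap_apply_module]
      module
    rwa [e] at this
  have hint : (interior (convexHull ℝ T)).Nonempty := by
    rw [interior_convexHull_nonempty_iff_affineSpan_eq_top]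
    refine affineSpan_eq_top_of_zero_mem h0T (eq_top_iff.2 ?_)
    rw [← v.span_eq]
    exact Submodule.span_mono (subset_insert _ _)
  have hT1 : ∀ x ∈ convexHull ℝ T, 1 ≤ inner ℝ ν x := fun x hx => by
    have : inner ℝ (-ν) (x - 0) ≤ -1 := inner_sub_le_of_mem_convexHull (fun y hy => by
      rcases hy with rfl | ⟨i, rfl⟩
      · simp [inner_smul_right, hνp]
      · simp [hv]) hx
    simp only [sub_zero, inner_neg_left] at this
    linarith
  have hT2 : ∀ x ∈ interior (convexHull ℝ T), 1 < inner ℝ ν x := fun x hx => by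
    have hc : ContinuousAt (fun ε : ℝ => x - ε • ν) 0 := by fun_prop
    have hnh := hc.preimage_mem_nhds
      (by simpa using mem_interior_iff_mem_nhds.1 hx : convexHull ℝ T ∈ 𝓝 (x - (0 : ℝ) • ν))
    obtain ⟨ε, h, hε⟩ := ((eventually_iff.2 hnh).filter_mono nhdsWithin_le_nhds |>.and
      (self_mem_nhdsWithin (s := Ioi (0 : ℝ)))).exists
    have h1 := hT1 _ h
    rw [inner_sub_right, inner_smul_right] at h1
    have : 0 < ε * inner ℝ ν ν := mul_pos hε (real_inner_self_pos.2 hν0)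
    linarith
  refine ⟨volume (interior (convexHull ℝ T)), (isOpen_interior.measure_pos _ hint).ne',
    fun t ht => ?_⟩
  set g := LinearMap.transvection ((-(1 - t)) • (innerSL ℝ ν).toLinearMap) p with hg
  have hgx : ∀ x, g x = x - ((1 - t) * inner ℝ ν x) • p := fun x => by
    simp only [hg, LinearMap.transvection.apply, LinearMap.smul_apply,
      ContinuousLinearMap.coe_coe, innerSL_apply_apply, smul_eq_mul]
    module
  have hdet : LinearMap.det g = t := by
    rw [hg, LinearMap.transvection.det]
    simp [hνp]
  set Q := (fun x => x + (1 - t) • p) '' (g '' interior (convexHull ℝ T)) with hQ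
  have hQvol : volume Q = ENNReal.ofReal t * volume (interior (convexHull ℝ T)) := by
    have h1 : volume Q = volume (g '' interior (convexHull ℝ T)) := by simp [hQ]
    rw [h1, Measure.addHaar_image_linearMap, hdet, abs_of_pos ht]
  have hQ1 : ∀ x ∈ Q, 1 < inner ℝ ν x := by
    rintro _ ⟨_, ⟨x, hx, rfl⟩, rfl⟩
    have := hT2 x hx
    simp only [hgx, inner_add_right, inner_sub_right, inner_smul_right, hνp]
    nlinarith
  have hTK : convexHull ℝ T ⊆ (fun x => g x + (1 - t) • p) ⁻¹'
      convexHull ℝ (insert ((1 + t) • p) S) := by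
    refine convexHull_min ?_ ?_
    · rintro y (rfl | ⟨i, rfl⟩)
      · have e : g ((2 : ℝ) • p) + (1 - t) • p = (1 + t) • p := by
          rw [hgx, inner_smul_right, hνp]
          module
        rw [mem_preimage, e]
        exact subset_convexHull ℝ _ (mem_insert _ _)
      · have e : g (v i) + (1 - t) • p = v i := by
          rw [hgx, hv]
          module
        rw [mem_preimage, e]
        exact subset_convexHull ℝ _ (mem_insert_of_mem _ (hvS i))
    · have := ((convex_convexHull ℝ (insert ((1 + t) • p) S)).translate_preimage_left
        ((1 - t) • p)).linear_preimage g
      exact this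
  have hQK : Q ⊆ convexHull ℝ (insert ((1 + t) • p) S) := by
    rintro _ ⟨_, ⟨x, hx, rfl⟩, rfl⟩
    exact hTK (interior_subset hx)
  have hdisj : Disjoint Q (convexHull ℝ S) :=
    disjoint_left.2 fun x hx hxS => (hQ1 x hx).not_ge (hν x hxS)
  rw [← hQvol, add_comm, ← measure_union hdisj (hS.isCompact_convexHull ℝ).measurableSet]
  exact measure_mono (union_subset hQK (convexHull_mono (subset_insert _ _)))

/-- Moving a point of a facet outwards by `t` removes at most a multiple of `t ^ n` from the volume
of the polar body, uniformly over the centers at distance at least `δ` from the boundary: on the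
removed part, all `n` facet vertices satisfy `1 - O(t) ≤ ⟪y, v i - z⟫ ≤ 1`. -/
theorem exists_volume_polar_loss {n : ℕ} (hn : 0 < n) {S : Set (EuclideanSpace ℝ (Fin n))}
    {ν p : EuclideanSpace ℝ (Fin n)}
    (v : Module.Basis (Fin n) ℝ (EuclideanSpace ℝ (Fin n))) (hvS : ∀ i, v i ∈ S)
    (hv : ∀ i, inner ℝ ν (v i) = 1) (hν : ∀ x ∈ convexHull ℝ S, inner ℝ ν x ≤ 1)
    (hp : p = (n : ℝ)⁻¹ • ∑ i, v i) {δ : ℝ} (hδ : 0 < δ) :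
    ∃ c : ℝ≥0∞, c ≠ ⊤ ∧ ∀ t : ℝ, 0 < t →
      ∀ z : EuclideanSpace ℝ (Fin n), closedBall z δ ⊆ convexHull ℝ S →
      volume (centeredPolar (convexHull ℝ S) z) ≤
        volume (centeredPolar (convexHull ℝ (insert ((1 + t) • p) S)) z) +
          ENNReal.ofReal (t ^ n) * c := by
  have hn0 : (n : ℝ) ≠ 0 := by positivity
  have hνp : inner ℝ ν p = 1 := hp ▸ inner_centroid_eq_one hn hv
  have hν0 : ν ≠ 0 := by
    rintro rfl
    simp at hνp
  have hνn : 0 < ‖ν‖ := norm_pos_iff.2 hν0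
  have hp0 : 0 < ‖p‖ := norm_pos_iff.2 fun h => by simp [h] at hνp
  set W : Set (EuclideanSpace ℝ (Fin n)) := {w | ∀ i, inner ℝ w (v i) ∈ Icc (0 : ℝ) 1} with hW
  have hWvol : volume W ≠ ⊤ := by
    let M : EuclideanSpace ℝ (Fin n) →ₗ[ℝ] (Fin n → ℝ) :=
      LinearMap.pi fun i => (innerSL ℝ (v i)).toLinearMap
    have hM : ∀ w i, M w i = inner ℝ w (v i) := fun w i => by
      simp [M, real_inner_comm]
    have hker : LinearMap.ker M = ⊥ := by
      rw [LinearMap.ker_eq_bot']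
      intro w hw
      refine InnerProductSpace.ext_inner_right_basis v fun i => ?_
      rw [← hM, hw, inner_zero_left, Pi.zero_apply]
    obtain ⟨C, -, hC⟩ := M.toContinuousLinearMap.exists_antilipschitzWith hker
    have hbdd := hC.isBounded_preimage (isBounded_Icc (0 : Fin n → ℝ) 1)
    refine ((measure_mono fun w hw => ?_).trans_lt hbdd.measure_lt_top).ne
    refine ⟨fun i => ?_, fun i => ?_⟩
    · exact (hM w i).symm ▸ (hw i).1
    · exact (hM w i).symm ▸ (hw i).2
  set C : ℝ := n * ‖p‖ / δ with hC
  have hCpos : 0 < C := by positivity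
  refine ⟨ENNReal.ofReal (C ^ n) * (ENNReal.ofReal (δ * ‖ν‖)⁻¹ * volume W),
    ENNReal.mul_ne_top ENNReal.ofReal_ne_top (ENNReal.mul_ne_top ENNReal.ofReal_ne_top hWvol),
    fun t ht z hz => ?_⟩
  -- the distance of `z` to the facet hyperplane is `(1 - ⟪ν, z⟫) / ‖ν‖`
  have hd : δ * ‖ν‖ ≤ 1 - inner ℝ ν z := by
    have h1 := hν _ (hz (add_div_norm_smul_mem_closedBall (y := ν) hδ.le))
    rw [inner_add_right, inner_smul_right, div_norm_mul_inner_self] at h1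
    linarith
  have hdpos : 0 < 1 - inner ℝ ν z := lt_of_lt_of_le (by positivity) hd
  -- `⟪y, v i - z⟫ = ⟪T y, v i⟫`, which reduces the removed part to a fixed parallelepiped
  set T := LinearMap.transvection (-(innerSL ℝ z).toLinearMap) ν with hT
  have hTy : ∀ y, T y = y - (inner ℝ y z : ℝ) • ν := fun y => by
    simp [hT, LinearMap.transvection.apply, sub_eq_add_neg, real_inner_comm]
  have hdet : LinearMap.det T = 1 - inner ℝ ν z := by
    rw [hT, LinearMap.transvection.det]
    simp [sub_eq_add_neg, real_inner_comm]
  set R : Set (EuclideanSpace ℝ (Fin n)) :=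
    (fun y => y + -ν) ⁻¹' ((-(C * t)) • W) with hR
  have hRvol : volume R = ENNReal.ofReal ((C * t) ^ n) * volume W := by
    rw [hR, measure_preimage_add_right, Measure.addHaar_smul]
    simp [abs_of_pos hCpos, abs_of_pos ht]
  have hcover : centeredPolar (convexHull ℝ S) z ⊆
      centeredPolar (convexHull ℝ (insert ((1 + t) • p) S)) z ∪ T ⁻¹' R := by
    intro y hy
    by_cases hyt : inner ℝ y ((1 + t) • p - z) ≤ 1
    · left
      rw [centeredPolar_convexHull]
      rintro x (rfl | hx)
      · exact hyt
      · exact hy x (subset_convexHull ℝ S hx)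
    · right
      push Not at hyt
      have hyn : ‖y‖ ≤ 1 / δ := by
        simpa using centeredPolar_subset_closedBall hδ hz hy
      have hle : ∀ i, inner ℝ y (v i - z) ≤ 1 := fun i =>
        hy _ (subset_convexHull ℝ S (hvS i))
      have hyp : inner ℝ y p ≤ 1 / δ * ‖p‖ :=
        (real_inner_le_norm _ _).trans (by gcongr)
      have hsum : ∑ i, inner ℝ y (v i - z) = n * inner ℝ y (p - z) := by
        rw [← inner_sum, hp, Finset.sum_sub_distrib, inner_sub_right, inner_sub_right,
          inner_smul_right]
        simp only [Finset.sum_const, Finset.card_univ, Fintype.card_fin, ← Nat.cast_smul_eq_nsmul ℝ,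
          inner_smul_right]
        field_simp
      have hsum' : (n : ℝ) - C * t ≤ ∑ i, inner ℝ y (v i - z) := by
        have h1 : 1 - t * (1 / δ * ‖p‖) ≤ inner ℝ y (p - z) := by
          have e : (1 + t) • p - z = (p - z) + t • p := by module
          rw [e, inner_add_right, inner_smul_right] at hyt
          nlinarith
        calc (n : ℝ) - C * t = n * (1 - t * (1 / δ * ‖p‖)) := by rw [hC]; ring
          _ ≤ n * inner ℝ y (p - z) := by gcongr
          _ = _ := hsum.symm
      have hge : ∀ i, 1 - C * t ≤ inner ℝ y (v i - z) := fun i => by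
        have h1 : ∑ j ∈ Finset.univ.erase i, inner ℝ y (v j - z) ≤ (n : ℝ) - 1 := by
          calc ∑ j ∈ Finset.univ.erase i, inner ℝ y (v j - z)
              ≤ ∑ j ∈ Finset.univ.erase i, (1 : ℝ) := Finset.sum_le_sum fun j _ => hle j
            _ = (n : ℝ) - 1 := by
              rw [Finset.sum_const, Finset.card_erase_of_mem (Finset.mem_univ i)]
              simp [Nat.cast_sub (Nat.one_le_iff_ne_zero.2 hn.ne')]
        have h2 := Finset.add_sum_erase Finset.univ (fun j => inner ℝ y (v j - z))
          (Finset.mem_univ i)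
        linarith
      refine mem_smul_set.2 ⟨(C * t)⁻¹ • (ν - T y), fun i => ?_, ?_⟩
      · have e : inner ℝ ((C * t)⁻¹ • (ν - T y)) (v i) =
            (C * t)⁻¹ * (1 - inner ℝ y (v i - z)) := by
          rw [hTy, inner_smul_left, inner_sub_left, inner_sub_left, inner_smul_left, hv,
            inner_sub_right]
          simp
        have hCt : 0 < C * t := by positivity
        rw [e]
        refine ⟨mul_nonneg (by positivity) (by linarith [hle i]), ?_⟩
        rw [inv_mul_le_iff₀ hCt]
        linarith [hge i]
      · rw [smul_smul, neg_mul, mul_inv_cancel₀ (by positivity)]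
        module
  have hfin : volume (T ⁻¹' R) ≤ ENNReal.ofReal (t ^ n) *
      (ENNReal.ofReal (C ^ n) * (ENNReal.ofReal (δ * ‖ν‖)⁻¹ * volume W)) := by
    rw [Measure.addHaar_preimage_linearMap _ (by rw [hdet]; exact hdpos.ne'), hRvol, hdet,
      mul_pow, ENNReal.ofReal_mul (by positivity), abs_of_pos (inv_pos.2 hdpos)]
    calc _ ≤ ENNReal.ofReal (δ * ‖ν‖)⁻¹ *
          (ENNReal.ofReal (C ^ n) * ENNReal.ofReal (t ^ n) * volume W) := by gcongr
      _ = _ := by ring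
  exact (measure_mono hcover).trans ((measure_union_le _ _).trans (by gcongr))

/-- Centers near the boundary are irrelevant for the infimum that defines the volume product: their
polar bodies have large volume. -/
theorem exists_volume_polar_ge {n : ℕ} {S : Set (EuclideanSpace ℝ (Fin n))} (hS : S.Finite)
    {p : EuclideanSpace ℝ (Fin n)} (hp : p ∈ convexHull ℝ S) {R : ℝ} (hR : 0 < R)
    (hSR : convexHull ℝ S ⊆ closedBall 0 (R / 2)) (N : ℕ) :
    ∃ δ : ℝ, 0 < δ ∧ ∀ t : ℝ, 0 < t → t ≤ 1 → t * ‖p‖ ≤ δ →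
      ∀ z ∈ convexHull ℝ (insert ((1 + t) • p) S), ¬ closedBall z δ ⊆ convexHull ℝ S →
      (N : ℝ≥0∞) * volume (ball (0 : EuclideanSpace ℝ (Fin n)) (1 / (2 * R) / 2)) ≤
        volume (centeredPolar (convexHull ℝ (insert ((1 + t) • p) S)) z) := by
  set r : ℝ := 1 / (2 * R) with hr
  have hrpos : 0 < r := by positivity
  refine ⟨1 / (4 * r * N + 1), by positivity, fun t ht ht1 htp z hz hball => ?_⟩
  set δ : ℝ := 1 / (4 * r * N + 1) with hδ
  have hδpos : 0 < δ := by positivity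
  have hpn : ‖p‖ ≤ R / 2 := by simpa using hSR hp
  have hball0 : convexHull ℝ (insert ((1 + t) • p) S) ⊆ closedBall 0 R := by
    refine convexHull_min ?_ (convex_closedBall _ _)
    rintro x (rfl | hx)
    · rw [mem_closedBall_zero_iff, norm_smul, Real.norm_eq_abs, abs_of_pos (by linarith)]
      nlinarith [norm_nonneg p]
    · exact closedBall_subset_closedBall (by linarith) (hSR (subset_convexHull ℝ S hx))
  have hballz : convexHull ℝ (insert ((1 + t) • p) S) ⊆ closedBall z (2 * R) := by
    refine hball0.trans (closedBall_subset_closedBall' ?_)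
    have : dist 0 z ≤ R := by simpa [dist_comm] using hball0 hz
    linarith
  obtain ⟨u, hu0, hu⟩ := exists_inner_lt_of_not_closedBall_subset (convex_convexHull ℝ S)
    (hS.isClosed_convexHull ℝ) ⟨p, hp⟩ hball
  have hun : 0 < ‖u‖ := norm_pos_iff.2 hu0
  have hmem : (1 / (2 * δ * ‖u‖)) • u ∈
      centeredPolar (convexHull ℝ (insert ((1 + t) • p) S)) z := by
    have key : ∀ x ∈ insert ((1 + t) • p) S, inner ℝ u (x - z) ≤ 2 * δ * ‖u‖ := by
      rintro x (rfl | hx)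
      · have e : (1 + t) • p - z = (p - z) + t • p := by module
        rw [e, inner_add_right, inner_smul_right]
        have h1 := (hu p hp).le
        have h2 : t * inner ℝ u p ≤ δ * ‖u‖ := by
          calc t * inner ℝ u p ≤ t * (‖u‖ * ‖p‖) := by
                gcongr
                exact real_inner_le_norm _ _
            _ = t * ‖p‖ * ‖u‖ := by ring
            _ ≤ δ * ‖u‖ := by gcongr
        linarith
      · have := hu x (subset_convexHull ℝ S hx)
        nlinarith [mul_pos hδpos hun]
    rw [centeredPolar_convexHull]
    intro x hx
    rw [inner_smul_left, conj_trivial, one_div, inv_mul_le_iff₀ (by positivity), mul_one]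
    exact key x hx
  refine mul_volume_ball_le_of_convex (convex_centeredPolar _ _) hrpos
    (ball_subset_centeredPolar (by positivity) hballz) hmem N ?_
  rw [norm_smul, Real.norm_eq_abs, abs_of_pos (by positivity)]
  have e : 1 / (2 * δ * ‖u‖) * ‖u‖ = 2 * r * N + 1 / 2 := by
    rw [hδ]
    field_simp
    ring
  rw [e]
  linarith

theorem exists_volumeProduct_insert_gt_of_zero_mem {n : ℕ} (hn : 2 ≤ n)
    {S : Set (EuclideanSpace ℝ (Fin n))} (hS : S.Finite)
    (h0 : (0 : EuclideanSpace ℝ (Fin n)) ∈ interior (convexHull ℝ S)) :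
    ∃ p, volumeProduct (convexHull ℝ S) < volumeProduct (convexHull ℝ (insert p S)) := by
  have hn0 : 0 < n := by omega
  obtain ⟨ν, v, hvS, hv, hν⟩ := exists_facet hS h0
  set p := (n : ℝ)⁻¹ • ∑ i, v i with hp
  have hpK : p ∈ convexHull ℝ S := centroid_mem_convexHull hn0 hvS
  set K := convexHull ℝ S with hK
  have hKcomp : IsCompact K := hS.isCompact_convexHull ℝ
  have hfin : volumeProduct K < ⊤ := volumeProduct_lt_top hKcomp ⟨0, h0⟩
  obtain ⟨R, hR, hKR⟩ : ∃ R : ℝ, 0 < R ∧ K ⊆ closedBall 0 (R / 2) := by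
    obtain ⟨R, hR, h⟩ := hKcomp.isBounded.subset_closedBall_lt 0 0
    exact ⟨2 * R, by positivity, by simpa using h⟩
  have hKpos : volume K ≠ 0 :=
    ((isOpen_interior.measure_pos volume ⟨0, h0⟩).trans_le (measure_mono interior_subset)).ne'
  set l : ℝ≥0∞ := volume (ball (0 : EuclideanSpace ℝ (Fin n)) (1 / (2 * R))) with hl
  have hl0 : l ≠ 0 := (measure_ball_pos volume _ (by positivity)).ne'
  set l' : ℝ≥0∞ := volume (ball (0 : EuclideanSpace ℝ (Fin n)) (1 / (2 * R) / 2)) with hl'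
  have hl'0 : l' ≠ 0 := (measure_ball_pos volume _ (by positivity)).ne'
  obtain ⟨N, hN⟩ := ENNReal.exists_nat_mul_gt (mul_ne_zero hKpos hl'0)
    (ENNReal.add_lt_top.2 ⟨hfin, ENNReal.one_lt_top⟩).ne
  obtain ⟨δ, hδ, hfar⟩ := exists_volume_polar_ge hS hpK hR hKR N
  obtain ⟨c, hc, hloss⟩ := exists_volume_polar_loss hn0 v hvS hv hν hp hδ
  obtain ⟨q, hq, hgain⟩ := exists_volume_gain hn0 hS v hvS hv hν hp
  -- the gain is of order `t`, the loss only of order `t ^ 2`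
  obtain ⟨t, ht, ht1, htp, htc⟩ : ∃ t : ℝ, 0 < t ∧ t ≤ 1 ∧ t * ‖p‖ ≤ δ ∧
      ENNReal.ofReal t * (volume K * c) ≤ q * l / 2 := by
    have e1 : ∀ᶠ t : ℝ in 𝓝 0, t < 1 := eventually_lt_nhds one_pos
    have e2 : ∀ᶠ t : ℝ in 𝓝 0, t * ‖p‖ < δ :=
      ((by fun_prop : Continuous fun t : ℝ => t * ‖p‖).tendsto 0).eventually_lt_const (by simpa)
    have e3 : ∀ᶠ t : ℝ in 𝓝 0, ENNReal.ofReal t * (volume K * c) < q * l / 2 := by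
      have h1 : Tendsto (fun t : ℝ => ENNReal.ofReal t * (volume K * c)) (𝓝 0)
          (𝓝 (ENNReal.ofReal 0 * (volume K * c))) :=
        ENNReal.Tendsto.mul_const (ENNReal.continuous_ofReal.tendsto 0)
          (Or.inr (ENNReal.mul_ne_top hKcomp.measure_lt_top.ne hc))
      refine h1.eventually_lt_const ?_
      rw [ENNReal.ofReal_zero, zero_mul]
      exact ENNReal.half_pos (mul_ne_zero hq hl0)
    obtain ⟨t, ⟨⟨h1, h2⟩, h3⟩, h4⟩ := (((e1.and e2).and e3).filter_mono
      nhdsWithin_le_nhds |>.and (self_mem_nhdsWithin (s := Ioi (0 : ℝ)))).exists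
    exact ⟨t, h4, h1.le, h2.le, h3.le⟩
  refine ⟨(1 + t) • p, ?_⟩
  set K' := convexHull ℝ (insert ((1 + t) • p) S) with hK'
  have hKK' : K ⊆ K' := convexHull_mono (subset_insert _ _)
  set η : ℝ≥0∞ := ENNReal.ofReal t * (q * l / 2) with hη
  have hη0 : η ≠ 0 := mul_ne_zero (by simpa using ht) (ENNReal.half_pos (mul_ne_zero hq hl0)).ne'
  suffices h : volumeProduct K + min η 1 ≤ volumeProduct K' from
    (ENNReal.lt_add_right hfin.ne (lt_min (pos_iff_ne_zero.2 hη0) one_pos).ne').trans_le h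
  refine le_iInf₂ fun z hz => ?_
  rw [volume_polarAt]
  have hzK' : z ∈ K' := interior_subset hz
  by_cases hball : closedBall z δ ⊆ K
  · have hzK : z ∈ interior K :=
      mem_interior_iff_mem_nhds.2 (mem_of_superset (closedBall_mem_nhds z hδ) hball)
    have h1 : volumeProduct K ≤ volume K * volume (centeredPolar K z) := by
      rw [← volume_polarAt]
      exact iInf₂_le z hzK
    have h2 := hloss t ht z hball
    have h3 := hgain t ht
    have h4 : l ≤ volume (centeredPolar K' z) := by
      refine measure_mono (ball_subset_centeredPolar (by positivity) ?_)
      have hK'R : K' ⊆ closedBall 0 R := by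
        refine convexHull_min ?_ (convex_closedBall _ _)
        rintro x (rfl | hx)
        · have hpn : ‖p‖ ≤ R / 2 := by simpa using hKR hpK
          rw [mem_closedBall_zero_iff, norm_smul, Real.norm_eq_abs, abs_of_pos (by linarith)]
          nlinarith [norm_nonneg p]
        · exact closedBall_subset_closedBall (by linarith) (hKR (subset_convexHull ℝ S hx))
      refine hK'R.trans (closedBall_subset_closedBall' ?_)
      have : dist 0 z ≤ R := by simpa [dist_comm] using hK'R hzK'
      linarith
    have h5 : ENNReal.ofReal (t ^ n) ≤ ENNReal.ofReal t * ENNReal.ofReal t := by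
      rw [← ENNReal.ofReal_mul ht.le, ← pow_two]
      exact ENNReal.ofReal_le_ofReal (pow_le_pow_of_le_one ht.le ht1 hn)
    have h6 : volume K * (ENNReal.ofReal (t ^ n) * c) ≤ η := by
      calc volume K * (ENNReal.ofReal (t ^ n) * c)
          ≤ volume K * (ENNReal.ofReal t * ENNReal.ofReal t * c) := by gcongr
        _ = ENNReal.ofReal t * (ENNReal.ofReal t * (volume K * c)) := by ring
        _ ≤ η := by rw [hη]; gcongr
    calc volumeProduct K + min η 1
        ≤ volume K * (volume (centeredPolar K' z) + ENNReal.ofReal (t ^ n) * c) + η := by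
          gcongr
          · exact h1.trans (by gcongr)
          · exact min_le_left _ _
      _ ≤ volume K * volume (centeredPolar K' z) + η + η := by
          rw [mul_add]
          gcongr
      _ = volume K * volume (centeredPolar K' z) + ENNReal.ofReal t * q * l := by
          rw [add_assoc, hη, ← mul_add, ENNReal.add_halves, mul_assoc]
      _ ≤ volume K * volume (centeredPolar K' z) +
            ENNReal.ofReal t * q * volume (centeredPolar K' z) := by gcongr
      _ = (volume K + ENNReal.ofReal t * q) * volume (centeredPolar K' z) := by rw [add_mul]
      _ ≤ volume K' * volume (centeredPolar K' z) := by gcongr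
  · have h1 := hfar t ht ht1 htp z hzK' hball
    calc volumeProduct K + min η 1 ≤ volumeProduct K + 1 := by
          gcongr
          exact min_le_right _ _
      _ ≤ N * (volume K * l') := hN.le
      _ = volume K * (N * l') := by ring
      _ ≤ volume K' * volume (centeredPolar K' z) := by gcongr

/-- In dimension at least two, the volume product of any polytope can be increased by adding one
vertex. -/
theorem exists_volumeProduct_insert_gt {n : ℕ} (hn : 2 ≤ n)
    {S : Set (EuclideanSpace ℝ (Fin n))} (hS : S.Finite)
    (hne : (interior (convexHull ℝ S)).Nonempty) :
    ∃ p, volumeProduct (convexHull ℝ S) < volumeProduct (convexHull ℝ (insert p S)) := by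
  obtain ⟨o, ho⟩ := hne
  have h0 : (0 : EuclideanSpace ℝ (Fin n)) ∈
      interior (convexHull ℝ ((fun x => x + -o) '' S)) := by
    have hint := (Homeomorph.addRight (-o)).image_interior (convexHull ℝ S)
    rw [convexHull_image_add]
    exact hint ▸ ⟨o, ho, by simp⟩
  obtain ⟨p, hp⟩ := exists_volumeProduct_insert_gt_of_zero_mem hn (hS.image _) h0
  refine ⟨p + o, ?_⟩
  have e : insert p ((fun x => x + -o) '' S) = (fun x => x + -o) '' insert (p + o) S := by
    rw [image_insert_eq]
    simp
  rwa [e, convexHull_image_add, convexHull_image_add, volumeProduct_image_add,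
    volumeProduct_image_add] at hp

/-! ### Upper semicontinuity of the volume product -/

/-- A quantitative stability estimate: if the points of a configuration move by at most `s * r`,
where the convex hull contains the ball of radius `r` around `z`, then the hull and its polar body
around `z` are changed at most by dilations with factors `1 + s` and `(1 - s)⁻¹`. -/
theorem volume_mul_volume_polar_le_of_near {n : ℕ} {ι : Type*} {x x' : ι → EuclideanSpace ℝ (Fin n)}
    {z : EuclideanSpace ℝ (Fin n)} {r s : ℝ} (hr : 0 < r) (hs : 0 < s) (hs1 : s < 1)
    (hz : closedBall z r ⊆ convexHull ℝ (range x)) (hx : ∀ i, ‖x' i - x i‖ ≤ s * r) :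
    volume (convexHull ℝ (range x')) * volume (polarAt (convexHull ℝ (range x')) z) ≤
      ENNReal.ofReal (((1 + s) / (1 - s)) ^ n) *
        (volume (convexHull ℝ (range x)) * volume (polarAt (convexHull ℝ (range x)) z)) := by
  have h1s : 0 < 1 - s := by linarith
  set K := convexHull ℝ (range x) with hK
  have hvol : volume (convexHull ℝ (range x')) ≤ ENNReal.ofReal ((1 + s) ^ n) * volume K := by
    have hsub : convexHull ℝ (range x') ⊆ AffineMap.homothety z (1 + s) '' K := by
      refine convexHull_min ?_ ((convex_convexHull ℝ _).affine_image _)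
      rintro _ ⟨i, rfl⟩
      have hb : z + s⁻¹ • (x' i - x i) ∈ K := by
        apply hz
        rw [mem_closedBall, dist_eq_norm, add_sub_cancel_left, norm_smul, norm_inv,
          Real.norm_eq_abs, abs_of_pos hs, inv_mul_le_iff₀ hs]
        exact hx i
      refine ⟨(1 + s)⁻¹ • x i + (s * (1 + s)⁻¹) • (z + s⁻¹ • (x' i - x i)),
        convex_convexHull ℝ _ (subset_convexHull ℝ _ (mem_range_self i)) hb (by positivity)
          (by positivity) (by field_simp), ?_⟩
      rw [AffineMap.homothety_apply, vsub_eq_sub, vadd_eq_add]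
      have e : (1 + s) • ((1 + s)⁻¹ • x i + (s * (1 + s)⁻¹) • (z + s⁻¹ • (x' i - x i)) - z) =
          ((1 + s) * (1 + s)⁻¹) • x i + (s * ((1 + s) * (1 + s)⁻¹)) • z +
            (s * s⁻¹ * ((1 + s) * (1 + s)⁻¹)) • (x' i - x i) - (1 + s) • z := by module
      rw [e, mul_inv_cancel₀ (by positivity), mul_inv_cancel₀ hs.ne']
      module
    refine (measure_mono hsub).trans_eq ?_
    rw [Measure.addHaar_image_homothety, finrank_euclideanSpace_fin, abs_of_pos (by positivity)]
  have hpol : volume (polarAt (convexHull ℝ (range x')) z) ≤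
      ENNReal.ofReal (((1 - s)⁻¹) ^ n) * volume (polarAt K z) := by
    rw [volume_polarAt, volume_polarAt]
    have hsub : centeredPolar (convexHull ℝ (range x')) z ⊆ (1 - s)⁻¹ • centeredPolar K z := by
      intro y hy
      have h1 : ∀ i, inner ℝ y (x i - z) ≤ 1 + s * (r * ‖y‖) := fun i => by
        have e : x i - z = (x' i - z) - (x' i - x i) := by abel
        have h2 := hy _ (subset_convexHull ℝ _ (mem_range_self i))
        have h3 : -inner ℝ y (x' i - x i) ≤ ‖y‖ * (s * r) :=
          (neg_le_abs _).trans ((abs_real_inner_le_norm _ _).trans (by gcongr; exact hx i))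
        rw [e, inner_sub_right]
        linarith
      have h2 : r * ‖y‖ ≤ 1 + s * (r * ‖y‖) :=
        mul_norm_le_of_inner_sub_le hr.le hz fun w hw =>
          inner_sub_le_of_mem_convexHull (by rintro _ ⟨i, rfl⟩; exact h1 i) hw
      rw [mem_inv_smul_set_iff₀ h1s.ne', hK, centeredPolar_convexHull]
      rintro _ ⟨i, rfl⟩
      rw [inner_smul_left, conj_trivial]
      nlinarith [h1 i]
    refine (measure_mono hsub).trans_eq ?_
    rw [Measure.addHaar_smul, finrank_euclideanSpace_fin, abs_of_pos (by positivity)]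
  calc _ ≤ (ENNReal.ofReal ((1 + s) ^ n) * volume K) *
        (ENNReal.ofReal (((1 - s)⁻¹) ^ n) * volume (polarAt K z)) := by gcongr
    _ = _ := by
      rw [mul_mul_mul_comm, ← ENNReal.ofReal_mul (by positivity), ← mul_pow, div_eq_mul_inv]

theorem mem_interior_convexHull_of_near {n : ℕ} {ι : Type*} [Finite ι]
    {x x' : ι → EuclideanSpace ℝ (Fin n)} {z : EuclideanSpace ℝ (Fin n)} {r s : ℝ} (hr : 0 < r)
    (hs1 : s < 1) (hz : closedBall z r ⊆ convexHull ℝ (range x))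
    (hx : ∀ i, ‖x' i - x i‖ ≤ s * r) : z ∈ interior (convexHull ℝ (range x')) := by
  have hρ : 0 < (1 - s) / 2 * r := mul_pos (by linarith) hr
  have hne : (range x).Nonempty :=
    convexHull_nonempty_iff.1 ⟨z, hz (mem_closedBall_self hr.le)⟩
  obtain ⟨_, i, -⟩ := hne
  refine mem_interior_iff_mem_nhds.2 (mem_of_superset (closedBall_mem_nhds z hρ) ?_)
  by_contra hball
  obtain ⟨u, hu0, hu⟩ := exists_inner_lt_of_not_closedBall_subset (convex_convexHull ℝ _)
    ((finite_range x').isClosed_convexHull ℝ) ⟨x' i, subset_convexHull ℝ _ (mem_range_self i)⟩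
    hball
  have hun : 0 < ‖u‖ := norm_pos_iff.2 hu0
  have h1 : ∀ i, inner ℝ u (x i - z) ≤ (1 + s) / 2 * r * ‖u‖ := fun i => by
    have e : x i - z = (x' i - z) - (x' i - x i) := by abel
    have h2 := hu _ (subset_convexHull ℝ _ (mem_range_self i))
    have h3 : -inner ℝ u (x' i - x i) ≤ ‖u‖ * (s * r) :=
      (neg_le_abs _).trans ((abs_real_inner_le_norm _ _).trans (by gcongr; exact hx i))
    rw [e, inner_sub_right]
    linarith
  have h2 : r * ‖u‖ ≤ (1 + s) / 2 * r * ‖u‖ :=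
    mul_norm_le_of_inner_sub_le hr.le hz fun w hw =>
      inner_sub_le_of_mem_convexHull (by rintro _ ⟨i, rfl⟩; exact h1 i) hw
  have : 0 < (1 - s) / 2 * (r * ‖u‖) := mul_pos (by linarith) (mul_pos hr hun)
  linarith

/-- Being an infimum over centers of locally continuous functions, the volume product of the convex
hull is upper semicontinuous in the configuration of points. -/
theorem upperSemicontinuous_volumeProduct_convexHull_range (n : ℕ) (ι : Type*) [Fintype ι] :
    UpperSemicontinuous fun x : ι → EuclideanSpace ℝ (Fin n) =>
      volumeProduct (convexHull ℝ (range x)) := by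
  intro x a ha
  obtain ⟨z, hz, hza⟩ := by simpa only [volumeProduct, iInf_lt_iff] using ha
  obtain ⟨r, hr, hb⟩ := nhds_basis_closedBall.mem_iff.1 (mem_interior_iff_mem_nhds.1 hz)
  have hlim : Tendsto (fun s : ℝ => ENNReal.ofReal (((1 + s) / (1 - s)) ^ n) *
      (volume (convexHull ℝ (range x)) * volume (polarAt (convexHull ℝ (range x)) z))) (𝓝 0)
      (𝓝 (ENNReal.ofReal (((1 + 0) / (1 - 0)) ^ n) *
      (volume (convexHull ℝ (range x)) * volume (polarAt (convexHull ℝ (range x)) z)))) := by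
    refine ENNReal.Tendsto.mul_const (ENNReal.tendsto_ofReal ?_) (Or.inr hza.ne_top)
    have : ContinuousAt (fun s : ℝ => ((1 + s) / (1 - s)) ^ n) 0 := by
      have : (1 : ℝ) - 0 ≠ 0 := by norm_num
      fun_prop (disch := assumption)
    exact this
  have e1 := hlim.eventually_lt_const (u := a) (by simpa using hza)
  have e2 : ∀ᶠ s : ℝ in 𝓝 0, s < 1 := eventually_lt_nhds one_pos
  obtain ⟨s, ⟨h1, hs1⟩, hs⟩ := ((e1.and e2).filter_mono nhdsWithin_le_nhds |>.and
    (self_mem_nhdsWithin (s := Ioi (0 : ℝ)))).exists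
  filter_upwards [closedBall_mem_nhds x (mul_pos hs hr)] with x' hx'
  have hnear : ∀ i, ‖x' i - x i‖ ≤ s * r := fun i => by
    rw [← dist_eq_norm]
    exact (dist_le_pi_dist x' x i).trans hx'
  exact ((iInf₂_le z (mem_interior_convexHull_of_near hr hs1 hb hnear)).trans
    (volume_mul_volume_polar_le_of_near hr hs hs1 hb hnear)).trans_lt h1

/-! ### Affine normalization -/

/-- A finite spanning set contains a basis with respect to which all its elements have coordinates
in `[-1, 1]`, namely one with determinant of maximal absolute value (by Cramer's rule). -/
theorem exists_basis_mem_abs_repr_le_one {n : ℕ} {A : Set (EuclideanSpace ℝ (Fin n))}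
    (hfin : A.Finite) (hA : Submodule.span ℝ A = ⊤) :
    ∃ b : Module.Basis (Fin n) ℝ (EuclideanSpace ℝ (Fin n)), (∀ i, b i ∈ A) ∧
      ∀ x ∈ A, ∀ i, |b.repr x i| ≤ 1 := by
  obtain ⟨b₀, hb₀⟩ := exists_basis_mem_of_span_eq_top hA
  have := hfin.to_subtype
  have : Nonempty (Fin n → A) := ⟨fun i => ⟨b₀ i, hb₀ i⟩⟩
  obtain ⟨w, hw⟩ := Finite.exists_max fun w : Fin n → A => |b₀.det fun i => (w i : _)|
  set w' : Fin n → EuclideanSpace ℝ (Fin n) := fun i => (w i : _) with hw'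
  have hpos : 0 < |b₀.det w'| := by
    refine lt_of_lt_of_le ?_ (hw fun i => ⟨b₀ i, hb₀ i⟩)
    simp [b₀.det_self]
  obtain ⟨hli, hsp⟩ := (b₀.is_basis_iff_det).2 (isUnit_iff_ne_zero.2 (abs_pos.1 hpos))
  let b := Module.Basis.mk hli hsp.ge
  have hb : ∀ i, b i = w' i := fun i => Module.Basis.mk_apply hli hsp.ge i
  refine ⟨b, fun i => hb i ▸ (w i).2, fun x hx i => ?_⟩
  have hlin : b₀.det.toMultilinearMap.toLinearMap w' i = b₀.det w' • b.coord i := by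
    refine b.ext fun j => ?_
    rw [LinearMap.smul_apply, Module.Basis.coord_apply, Module.Basis.repr_self, hb,
      MultilinearMap.toLinearMap_apply]
    rcases eq_or_ne j i with rfl | hji
    · simp
    · rw [Finsupp.single_eq_of_ne hji.symm, smul_zero]
      exact b₀.det.map_update_self w' hji.symm
  have h1 : b₀.det (Function.update w' i x) = b₀.det w' * b.repr x i := by
    have := congrArg (fun g => g x) hlin
    simpa using this
  have h2 := hw (Function.update w i ⟨x, hx⟩)
  have h3 : (fun j => (Function.update w i ⟨x, hx⟩ j : EuclideanSpace ℝ (Fin n))) =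
      Function.update w' i x := by
    ext1 j
    rcases eq_or_ne j i with rfl | hji
    · simp
    · simp [hji, hw']
  rw [h3, h1, abs_mul] at h2
  exact le_of_mul_le_mul_left (by simpa using h2) hpos

/-- Configurations of `m` points in the cube `[-1, 1]ⁿ` among which are the vertices of the standard
simplex. -/
def normalizedConfigurations (n m : ℕ) : Set (Fin m → EuclideanSpace ℝ (Fin n)) :=
  {x | (∀ i j, |x i j| ≤ 1) ∧ 0 ∈ range x ∧ ∀ j, EuclideanSpace.single j 1 ∈ range x}

theorem isCompact_normalizedConfigurations (n m : ℕ) :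
    IsCompact (normalizedConfigurations n m) := by
  have hmem : ∀ v : EuclideanSpace ℝ (Fin n),
      IsClosed {x : Fin m → EuclideanSpace ℝ (Fin n) | v ∈ range x} := fun v => by
    have e : {x : Fin m → EuclideanSpace ℝ (Fin n) | v ∈ range x} = ⋃ i, {x | x i = v} := by
      ext x
      simp
    rw [e]
    exact isClosed_iUnion_of_finite fun i => isClosed_eq (continuous_apply i) continuous_const
  have hclosed : IsClosed (normalizedConfigurations n m) := by
    have e : normalizedConfigurations n m = (⋂ i, ⋂ j, {x | |x i j| ≤ 1}) ∩
        ({x | 0 ∈ range x} ∩ ⋂ j, {x | EuclideanSpace.single j 1 ∈ range x}) := by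
      ext x
      simp [normalizedConfigurations]
    rw [e]
    refine (isClosed_iInter fun i => isClosed_iInter fun j => isClosed_le ?_ ?_).inter
      ((hmem 0).inter (isClosed_iInter fun j => hmem _))
    · fun_prop
    · exact continuous_const
  refine (isCompact_closedBall 0 (√n)).of_isClosed_subset hclosed fun x hx => ?_
  rw [mem_closedBall_zero_iff, pi_norm_le_iff_of_nonneg (Real.sqrt_nonneg _)]
  intro i
  rw [EuclideanSpace.norm_eq]
  refine Real.sqrt_le_sqrt ?_
  calc ∑ j, ‖x i j‖ ^ 2 ≤ ∑ _j : Fin n, (1 : ℝ) :=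
        Finset.sum_le_sum fun j _ => pow_le_one₀ (norm_nonneg _) (hx.1 i j)
    _ = n := by simp

theorem interior_convexHull_nonempty_of_mem_normalizedConfigurations {n m : ℕ}
    {x : Fin m → EuclideanSpace ℝ (Fin n)} (hx : x ∈ normalizedConfigurations n m) :
    (interior (convexHull ℝ (range x))).Nonempty := by
  rw [interior_convexHull_nonempty_iff_affineSpan_eq_top]
  refine affineSpan_eq_top_of_zero_mem (subset_affineSpan ℝ _ hx.2.1) (eq_top_iff.2 ?_)
  rw [← (EuclideanSpace.basisFun (Fin n) ℝ).toBasis.span_eq]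
  refine Submodule.span_mono ?_
  rintro _ ⟨j, rfl⟩
  simpa using hx.2.2 j

theorem exists_range_eq_of_ncard_le {α : Type*} {A : Set α} {m : ℕ} (hfin : A.Finite)
    (hne : A.Nonempty) (hm : A.ncard ≤ m) : ∃ x : Fin m → α, range x = A := by
  have := hfin.fintype
  have := hne.to_subtype
  obtain ⟨g⟩ := Function.Embedding.nonempty_of_card_le (α := A) (β := Fin m)
    (by rwa [Fintype.card_fin, ← Nat.card_eq_fintype_card, Nat.card_coe_set_eq])
  refine ⟨Subtype.val ∘ Function.invFun g, ?_⟩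
  rw [range_comp, (Function.invFun_surjective g.injective).range_eq, image_univ,
    Subtype.range_coe]

theorem exists_mem_normalizedConfigurations {n m : ℕ} {S : Set (EuclideanSpace ℝ (Fin n))}
    (hS : S.Finite) (hint : (interior (convexHull ℝ S)).Nonempty) (hm : S.ncard ≤ m) :
    ∃ x ∈ normalizedConfigurations n m,
      volumeProduct (convexHull ℝ (range x)) = volumeProduct (convexHull ℝ S) := by
  obtain ⟨o, ho⟩ : S.Nonempty := convexHull_nonempty_iff.1 (hint.mono interior_subset)
  set A := (fun x => x + -o) '' S with hA
  have hAspan : Submodule.span ℝ A = ⊤ := by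
    have h1 := interior_convexHull_nonempty_iff_affineSpan_eq_top.1 hint
    have h2 := vectorSpan_eq_span_vsub_set_right ℝ ho
    have h3 : vectorSpan ℝ S = ⊤ := by
      rw [← direction_affineSpan, h1, AffineSubspace.direction_top]
    rw [← h3, h2, hA]
    simp [sub_eq_add_neg]
  obtain ⟨b, hbA, hb⟩ := exists_basis_mem_abs_repr_le_one (hS.image _) hAspan
  let e := (EuclideanSpace.basisFun (Fin n) ℝ).toBasis
  let f : EuclideanSpace ℝ (Fin n) ≃L[ℝ] EuclideanSpace ℝ (Fin n) :=
    (b.equiv e (Equiv.refl _)).toContinuousLinearEquiv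
  have hfb : ∀ j, f (b j) = EuclideanSpace.single j 1 := fun j => by
    have : f (b j) = e j := b.equiv_apply j e (Equiv.refl _)
    rw [this]
    simp [e]
  have hfx : ∀ y j, f y j = b.repr y j := fun y j => by
    have h : e.repr (f y) j = b.repr y j := by
      simp [f, Module.Basis.equiv]
    rw [← h]
    simp [e]
  obtain ⟨x, hx⟩ := exists_range_eq_of_ncard_le (m := m) ((hS.image _).image f)
    (((show S.Nonempty from ⟨o, ho⟩).image _).image f)
    ((ncard_image_le (hS.image _)).trans ((ncard_image_le hS).trans hm))
  refine ⟨x, ⟨fun i j => ?_, ?_, fun j => ?_⟩, ?_⟩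
  · obtain ⟨y, hy, hyx⟩ : x i ∈ f '' A := hx ▸ mem_range_self i
    rw [← hyx, hfx]
    exact hb y hy j
  · rw [hx]
    exact ⟨0, ⟨o, ho, by simp⟩, map_zero f⟩
  · rw [hx]
    exact ⟨b j, hbA j, hfb j⟩
  · have h1 : convexHull ℝ (f '' A) = f '' convexHull ℝ A :=
      (f.toLinearEquiv.toLinearMap.image_convexHull A).symm
    rw [hx, h1, volumeProduct_image_linearEquiv, hA, convexHull_image_add,
      volumeProduct_image_add]

/-! ### Maximizers of the volume product -/

theorem IsPolytope.finite_extremePoints {n : ℕ} {K : Set (EuclideanSpace ℝ (Fin n))}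
    (hK : IsPolytope K) : (K.extremePoints ℝ).Finite := by
  obtain ⟨S, hS, rfl⟩ := hK
  exact hS.subset extremePoints_convexHull_subset

theorem IsPolytope.convexHull_extremePoints {n : ℕ} {K : Set (EuclideanSpace ℝ (Fin n))}
    (hK : IsPolytope K) : convexHull ℝ (K.extremePoints ℝ) = K := by
  have hfin := hK.finite_extremePoints
  obtain ⟨S, hS, rfl⟩ := hK
  rw [← (hfin.isClosed_convexHull ℝ).closure_eq]
  exact closure_convexHull_extremePoints (hS.isCompact_convexHull ℝ) (convex_convexHull ℝ S)

theorem convexHull_mem_polytopes {n m : ℕ} {S : Set (EuclideanSpace ℝ (Fin n))} (hS : S.Finite)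
    (hint : (interior (convexHull ℝ S)).Nonempty) (hm : S.ncard ≤ m) :
    convexHull ℝ S ∈ polytopes n m :=
  ⟨⟨S, hS, rfl⟩, hint, (ncard_le_ncard extremePoints_convexHull_subset hS).trans hm⟩

theorem volumeProduct_le_supVolumeProduct {n m : ℕ} {K : Set (EuclideanSpace ℝ (Fin n))}
    (hK : K ∈ polytopes n m) : volumeProduct K ≤ supVolumeProduct n m :=
  le_iSup₂ (f := fun K (_ : K ∈ polytopes n m) => volumeProduct K) K hK

/-- A polytope with nonempty interior in `ℝⁿ` has at least `n + 1` vertices. -/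
theorem add_one_le_numVertices {n : ℕ} {K : Set (EuclideanSpace ℝ (Fin n))} (hK : IsPolytope K)
    (hint : (interior K).Nonempty) : n + 1 ≤ numVertices K := by
  have hfin := hK.finite_extremePoints
  rw [← hK.convexHull_extremePoints, interior_convexHull_nonempty_iff_affineSpan_eq_top] at hint
  have hne : (K.extremePoints ℝ).Nonempty := by
    rw [← affineSpan_nonempty (k := ℝ), hint]
    exact ⟨0, trivial⟩
  have := hfin.fintype
  have := hne.to_subtype
  have h := finrank_vectorSpan_range_add_one_le ℝ
    ((↑) : K.extremePoints ℝ → EuclideanSpace ℝ (Fin n))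
  rw [Subtype.range_coe, ← direction_affineSpan, hint, AffineSubspace.direction_top, finrank_top,
    finrank_euclideanSpace_fin, ← Nat.card_eq_fintype_card] at h
  exact h

/-- After normalization the supremum runs over a compact set of configurations, on which the upper
semicontinuous volume product attains its maximum. -/
theorem exists_volumeProduct_eq_supVolumeProduct {n m : ℕ} (hm : n + 1 ≤ m) :
    ∃ K ∈ polytopes n m, volumeProduct K = supVolumeProduct n m := by
  -- the standard simplex has at most `n + 1 ≤ m` vertices
  have hne : (normalizedConfigurations n m).Nonempty := by
    set A : Set (EuclideanSpace ℝ (Fin n)) := insert 0 (range fun j => EuclideanSpace.single j 1)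
    have hfin : A.Finite := (finite_range _).insert 0
    obtain ⟨x, hx⟩ := exists_range_eq_of_ncard_le (m := m) hfin (insert_nonempty _ _) <| by
      refine (ncard_insert_le _ _).trans (le_trans ?_ hm)
      gcongr
      rw [← image_univ]
      exact (ncard_image_le finite_univ).trans (by simp)
    refine ⟨x, fun i j => ?_, hx ▸ mem_insert _ _, fun j => hx ▸ mem_insert_of_mem _ ⟨j, rfl⟩⟩
    rcases (hx ▸ mem_range_self i : x i ∈ A) with h | ⟨k, h⟩
    · simp [h]
    · rw [← h, PiLp.single_apply]
      split_ifs <;> simp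
  obtain ⟨x, hx, hmax⟩ := ((upperSemicontinuous_volumeProduct_convexHull_range n
    (Fin m)).upperSemicontinuousOn _).exists_isMaxOn hne (isCompact_normalizedConfigurations n m)
  have hxK : convexHull ℝ (range x) ∈ polytopes n m := by
    refine convexHull_mem_polytopes (finite_range x)
      (interior_convexHull_nonempty_of_mem_normalizedConfigurations hx) ?_
    rw [← image_univ]
    exact (ncard_image_le finite_univ).trans (by simp)
  refine ⟨_, hxK, le_antisymm (volumeProduct_le_supVolumeProduct hxK) (iSup₂_le ?_)⟩
  rintro K ⟨hK, hint, hKm⟩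
  obtain ⟨y, hy, hyK⟩ := exists_mem_normalizedConfigurations (m := m) hK.finite_extremePoints
    (by rwa [hK.convexHull_extremePoints]) hKm
  rw [hK.convexHull_extremePoints] at hyK
  exact hyK ▸ hmax hy

theorem supVolumeProduct_lt_top {n m : ℕ} (hm : n + 1 ≤ m) : supVolumeProduct n m < ⊤ := by
  obtain ⟨K, ⟨⟨S, hS, rfl⟩, hint, -⟩, h⟩ := exists_volumeProduct_eq_supVolumeProduct hm
  exact h ▸ volumeProduct_lt_top (hS.isCompact_convexHull ℝ) hint

theorem volumeProduct_lt_supVolumeProduct {n m : ℕ} (hn : 2 ≤ n)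
    {K : Set (EuclideanSpace ℝ (Fin n))} (hK : IsPolytope K) (hint : (interior K).Nonempty)
    (hm : numVertices K < m) : volumeProduct K < supVolumeProduct n m := by
  have hfin := hK.finite_extremePoints
  obtain ⟨p, hp⟩ := exists_volumeProduct_insert_gt hn hfin
    (by rwa [hK.convexHull_extremePoints])
  rw [hK.convexHull_extremePoints] at hp
  refine hp.trans_le (volumeProduct_le_supVolumeProduct (convexHull_mem_polytopes
    (hfin.insert p) (hint.mono (interior_mono ?_)) ((ncard_insert_le _ _).trans hm)))
  conv_lhs => rw [← hK.convexHull_extremePoints]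
  exact convexHull_mono (subset_insert _ _)

theorem theorem3p3 (n : ℕ) (hn : 1 ≤ n) :
    (∀ m : ℕ, n + 1 ≤ m →
      supVolumeProduct n m < ⊤ ∧
      ∃ K ∈ polytopes n m, volumeProduct K = supVolumeProduct n m) ∧
    (∀ m : ℕ, n + 1 ≤ m → (2 ≤ n ∨ m = n + 1) →
      ∀ K ∈ polytopes n m, volumeProduct K = supVolumeProduct n m → numVertices K = m) ∧
    (2 ≤ n → StrictMonoOn (supVolumeProduct n) (Set.Ici (n + 1))) := by
  refine ⟨fun m hm => ⟨supVolumeProduct_lt_top hm, exists_volumeProduct_eq_supVolumeProduct hm⟩,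
    fun m hm hnm K hK hKmax => ?_, fun hn2 m hm m' _ hmm' => ?_⟩
  · obtain ⟨hpoly, hint, hle⟩ := hK
    rcases hnm with hn2 | rfl
    · by_contra hne
      exact (volumeProduct_lt_supVolumeProduct hn2 hpoly hint (lt_of_le_of_ne hle hne)).ne hKmax
    · exact le_antisymm hle (add_one_le_numVertices hpoly hint)
  · obtain ⟨K, ⟨hpoly, hint, hle⟩, hK⟩ := exists_volumeProduct_eq_supVolumeProduct hm
    rw [← hK]
    exact volumeProduct_lt_supVolumeProduct hn2 hpoly hint (hle.trans_lt hmm')
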